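/- Let $(A,\mathfrak m,K)$ be a Noetherian local ring of dimension $d$, let $I$ be an $\mathfrak m$-primary ideal, and suppose that $Q\subseteq I$ is a parameter ideal of $A$ (an $\mathfrak m$-primary ideal generated by $d$ elements) that is a reduction of $I$, i.e. $I^{m+1}=QI^m$ for some $m>0$. Let $n=\mu(I)$ be the minimal number of generators of $I$, and let $x_1,\dots,x_n$ generate $I$ so that $Q=(x_1,\dots,x_d)$. Put $r=\min\{m\ge 0: I^{m+1}=QI^m\}$. Let $\mathcal R(I)=A[It]$ be the Rees algebra, $\mathcal F(I)=\mathcal R(I)/\mathfrak m\mathcal R(I)$ the fiber cone, and $\varphi:K[X_1,\dots,X_n]\to\mathcal F(I)$ the $K$-algebra homomorphism sending $X_k$ to the class of $x_kt$. For $i\ge 2$ let $u_i=\mu(I^i/QI^{i-1})$, and choose elements $y_{i1},\dots,y_{iu_i}$ of $\operatorname{Gen}(I^i)=\{x_{\ell_1}\cdots x_{\ell_i}:1\le \ell_1,\dots,\ell_i\le n\}$ whose classes generate $I^i/QI^{i-1}$. Choose monomials $Y_{ij}$ of degree $i$ in $K[X_1,\dots,X_n]$ such that $\varphi(Y_{ij})$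 is the class of $y_{ij}t^i$. For each $2\le i\le r+1$ and each tuple $(\ell_1,\dots,\ell_i)\in\{1,\dots,n\}^i$ with $x_{\ell_1}\cdots x_{\ell_i}\notin\{y_{i1},\dots,y_{iu_i}\}$, choose elements $a_j$ and $b_{p,q_1,\dots,q_{i-1}}$ of $A$ (depending on the tuple) with $$x_{\ell_1}\cdots x_{\ell_i}-\sum_{j=1}^{u_i}a_jy_{ij}=\sum_{1\le p\le d,\ 1\le q_1,\dots,q_{i-1}\le n}b_{p,q_1,\dots,q_{i-1}}\,x_px_{q_1}\cdots x_{q_{i-1}},$$ and, writing $\overline{c}$ for the image of $c\in A$ in $K$, put $$Z_{\ell_1,\dots,\ell_i}=X_{\ell_1}\cdots X_{\ell_i}-\sum_{j=1}^{u_i}\overline{a_j}\,Y_{ij}-\sum_{1\le p\le d,\ 1\le q_1,\dots,q_{i-1}\le n}\overline{b_{p,q_1,\dots,q_{i-1}}}\,X_pX_{q_1}\cdots X_{q_{i-1}}.$$ Let $\mathfrak a\subseteq K[X_1,\dots,X_n]$ be the ideal generated by all these $Z_{\ell_1,\dots,\ell_i}$. Then, for all such choices: 1. $\mathfrak a$ is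 a graded ideal, generated by homogeneous elements of degrees $i$ with $2\le i\le r+1$. 2. $\mathfrak a+(X_1,\dots,X_d)$ contains $(X_1,\dots,X_n)^{r+1}$. 3. $\dim K[X_1,\dots,X_n]/\mathfrak a=d$, and $(X_1,\dots,X_d)$ is a (graded) parameter ideal of $S=K[X_1,\dots,X_n]/\mathfrak a$, i.e. it is generated by $\dim S$ homogeneous elements of positive degree and $\dim S/(X_1,\dots,X_d)S=0$. -/

import Mathlib

open IsLocalRing MvPolynomial

noncomputable section

/-- A parameter ideal of a Noetherian local ring: an ideal generated by `dim A` elements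
whose radical is the maximal ideal. -/
def IsParameterIdeal {A : Type*} [CommRing A] [IsLocalRing A] (Q : Ideal A) : Prop :=
  ∃ e : ℕ, ringKrullDim A = e ∧ (∃ s : Fin e → A, Q = Ideal.span (Set.range s)) ∧
    Q.radical = maximalIdeal A

/-- `Q` is a reduction of `I`. -/
def IsReduction {A : Type*} [CommRing A] (Q I : Ideal A) : Prop :=
  Q ≤ I ∧ ∃ m : ℕ, 0 < m ∧ I ^ (m + 1) = Q * I ^ m

/-- The reduction number `min {m ≥ 0 : I ^ (m + 1) = Q I ^ m}` of `I` with respect to a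
reduction `Q` of `I`. -/
def reductionNumber {A : Type*} [CommRing A] (Q I : Ideal A) : ℕ :=
  sInf {m : ℕ | I ^ (m + 1) = Q * I ^ m}

/-- For `i ≥ 1`, the `A`-module `I ^ i / Q I ^ (i - 1)`, as a submodule of `A / Q I ^ (i - 1)`. -/
def powQuot {A : Type*} [CommRing A] (Q I : Ideal A) (i : ℕ) :
    Submodule A (A ⧸ (Q * I ^ (i - 1))) :=
  Submodule.map (Submodule.mkQ (Q * I ^ (i - 1))) (I ^ i)

/-- `u i`, the minimal number of generators of `I ^ i / Q I ^ (i - 1)`. -/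
def numGen {A : Type*} [CommRing A] (Q I : Ideal A) (i : ℕ) : ℕ :=
  (powQuot Q I i).spanFinrank

/-- The set of the products `x (ℓ 1) ⋯ x (ℓ i)`, which generate `I ^ i` when the `x k`
generate `I`. -/
def genPow {A : Type*} [CommRing A] {I : Ideal A} {n : ℕ} (x : Fin n → I) (i : ℕ) : Set A :=
  Set.range fun ℓ : Fin i → Fin n => ∏ s, (x (ℓ s) : A)

/-- The fiber cone `R(I) / 𝔪 R(I)`, where `R(I) = A[It]` is the Rees algebra. -/
abbrev FiberCone {A : Type*} [CommRing A] [IsLocalRing A] (I : Ideal A) : Type _ :=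
  reesAlgebra I ⧸ (maximalIdeal A).map (algebraMap A (reesAlgebra I))

/-- The class of `z t ^ i` in the fiber cone, for `z ∈ I ^ i`. -/
def fiberClass {A : Type*} [CommRing A] [IsLocalRing A] (I : Ideal A) (i : ℕ)
    (z : ↥(I ^ i)) : FiberCone I :=
  Ideal.Quotient.mk _
    (⟨Polynomial.monomial i (z : A), reesAlgebra.monomial_mem.2 z.2⟩ : reesAlgebra I)

/-- The ring homomorphism from the residue field `K = A / 𝔪` to the fiber cone. -/
def residueToFiberCone {A : Type*} [CommRing A] [IsLocalRing A] (I : Ideal A) :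
    ResidueField A →+* FiberCone I :=
  Ideal.quotientMap _ (algebraMap A (reesAlgebra I)) Ideal.le_comap_map

/-- The homomorphism of `K`-algebras `φ : K[X_1, …, X_n] → F(I)` that sends `X k` to the class
of `x k * t`. -/
def phi {A : Type*} [CommRing A] [IsLocalRing A] {I : Ideal A} {n : ℕ} (x : Fin n → I) :
    MvPolynomial (Fin n) (ResidueField A) →+* FiberCone I :=
  eval₂Hom (residueToFiberCone I) fun k =>
    fiberClass I 1 ⟨(x k : A), (pow_one I).symm ▸ (x k).2⟩

/-- `y` is a choice of elements of `I ^ i`, for `i ≥ 2`, all of them products of `i` of the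
`x k`, whose `u i` classes generate `I ^ i / Q I ^ (i - 1)`; so `Set.range (y i)` is `MinGen`. -/
def IsMinGenChoice {A : Type*} [CommRing A] (Q : Ideal A) {I : Ideal A} {n : ℕ}
    (x : Fin n → I) (y : ∀ i : ℕ, Fin (numGen Q I i) → ↥(I ^ i)) : Prop :=
  ∀ i, 2 ≤ i → (∀ j, (y i j : A) ∈ genPow x i) ∧
    Submodule.span A (Set.range fun j => Submodule.mkQ (Q * I ^ (i - 1)) (y i j : A)) =
      powQuot Q I i

/-- `Y i j` is (the exponent of) a monomial of degree `i` that `φ` sends to the class of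
`y i j * t ^ i`. -/
def IsMonomialChoice {A : Type*} [CommRing A] [IsLocalRing A] {Q I : Ideal A} {n : ℕ}
    (x : Fin n → I) (y : ∀ i : ℕ, Fin (numGen Q I i) → ↥(I ^ i))
    (Y : ∀ i : ℕ, Fin (numGen Q I i) → (Fin n →₀ ℕ)) : Prop :=
  ∀ i, 2 ≤ i → ∀ j, (Y i j).degree = i ∧
    phi x (monomial (Y i j) 1) = fiberClass I i (y i j)

/-- The index pairs of the generators `Z`: a degree `2 ≤ i ≤ r + 1` and a tuple `ℓ` of length `i`
such that `x (ℓ 1) ⋯ x (ℓ i)` is not one of the chosen generators `y i j`. -/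
def IsRelIndex {A : Type*} [CommRing A] {Q I : Ideal A} {n : ℕ}
    (x : Fin n → I) (y : ∀ i : ℕ, Fin (numGen Q I i) → ↥(I ^ i))
    (i : ℕ) (ℓ : Fin i → Fin n) : Prop :=
  2 ≤ i ∧ i ≤ reductionNumber Q I + 1 ∧
    ∏ s, (x (ℓ s) : A) ∉ Set.range fun j => (y i j : A)

/-- The coefficients `a` and `b` express each product `x (ℓ 1) ⋯ x (ℓ i)` that is not one of the
`y i j` through the `y i j` and the generators `x p * x (q 1) ⋯ x (q (i - 1))`, where `p` is among
the first `d` indices, of `Q I ^ (i - 1)`. -/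
def IsCoeffChoice {A : Type*} [CommRing A] {Q I : Ideal A} (d : ℕ) {n : ℕ}
    (x : Fin n → I) (y : ∀ i : ℕ, Fin (numGen Q I i) → ↥(I ^ i))
    (a : ∀ i : ℕ, (Fin i → Fin n) → Fin (numGen Q I i) → A)
    (b : ∀ i : ℕ, (Fin i → Fin n) → Fin n → (Fin (i - 1) → Fin n) → A) : Prop :=
  ∀ (i : ℕ) (ℓ : Fin i → Fin n), IsRelIndex x y i ℓ →
    ∏ s, (x (ℓ s) : A) - ∑ j, a i ℓ j * (y i j : A) =
      ∑ p with p.val < d, ∑ q : Fin (i - 1) → Fin n,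
        b i ℓ p q * ((x p : A) * ∏ s, (x (q s) : A))

/-- The polynomial `Z_{ℓ 1, …, ℓ i}`. -/
def zPoly {A : Type*} [CommRing A] [IsLocalRing A] {Q I : Ideal A} (d : ℕ) {n : ℕ}
    (Y : ∀ i : ℕ, Fin (numGen Q I i) → (Fin n →₀ ℕ))
    (a : ∀ i : ℕ, (Fin i → Fin n) → Fin (numGen Q I i) → A)
    (b : ∀ i : ℕ, (Fin i → Fin n) → Fin n → (Fin (i - 1) → Fin n) → A)
    (i : ℕ) (ℓ : Fin i → Fin n) : MvPolynomial (Fin n) (ResidueField A) :=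
  ∏ s, X (ℓ s) - ∑ j, C (residue A (a i ℓ j)) * monomial (Y i j) 1 -
    ∑ p with p.val < d, ∑ q : Fin (i - 1) → Fin n,
      C (residue A (b i ℓ p q)) * (X p * ∏ s, X (q s))

/-- The ideal `𝔞` generated by the polynomials `Z_{ℓ 1, …, ℓ i}`. -/
def relIdeal {A : Type*} [CommRing A] [IsLocalRing A] {Q I : Ideal A} (d : ℕ) {n : ℕ}
    (x : Fin n → I) (y : ∀ i : ℕ, Fin (numGen Q I i) → ↥(I ^ i))
    (Y : ∀ i : ℕ, Fin (numGen Q I i) → (Fin n →₀ ℕ))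
    (a : ∀ i : ℕ, (Fin i → Fin n) → Fin (numGen Q I i) → A)
    (b : ∀ i : ℕ, (Fin i → Fin n) → Fin n → (Fin (i - 1) → Fin n) → A) :
    Ideal (MvPolynomial (Fin n) (ResidueField A)) :=
  Ideal.span {f | ∃ (i : ℕ) (ℓ : Fin i → Fin n), IsRelIndex x y i ℓ ∧ f = zPoly d Y a b i ℓ}

/-- A (graded) parameter ideal of the standard graded ring `S = K[X] / 𝔞`, where `𝔞` is a
homogeneous ideal: an ideal `𝔮` generated by `dim S` classes of forms of positive degree, such that
`S / 𝔮` has Krull dimension zero. -/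
def IsGradedParameterIdeal {K σ : Type*} [Field K] {𝔞 : Ideal (MvPolynomial σ K)}
    (𝔮 : Ideal (MvPolynomial σ K ⧸ 𝔞)) : Prop :=
  ∃ e : ℕ, ringKrullDim (MvPolynomial σ K ⧸ 𝔞) = e ∧
    (∃ f : Fin e → MvPolynomial σ K, (∀ k, ∃ m : ℕ, 0 < m ∧ (f k).IsHomogeneous m) ∧
      𝔮 = Ideal.span (Set.range fun k => Ideal.Quotient.mk 𝔞 (f k))) ∧
    ringKrullDim ((MvPolynomial σ K ⧸ 𝔞) ⧸ 𝔮) = 0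

end

attribute [local instance] MvPolynomial.gradedAlgebra

/-!
The ideal `𝔞` is generated by forms `Z` of degree `i ≤ r + 1`, so it is homogeneous. In degree
`r + 1` the module `I ^ (r + 1) / Q I ^ r` vanishes, so every product of `r + 1` variables differs
from some `Z` by an element of `(X_1, …, X_d)` (`pow_idealOfVars_le_relIdeal_sup`).

The upper bound `dim K[X] / 𝔞 ≤ d` follows by a graded Nakayama argument: `K[X] / 𝔞` is a finite
module over `K[X_1, …, X_d]` (`ringKrullDim_le_of_pow_idealOfVars_le`).

For the lower bound, each `Z` is in the kernel of `φ`, because the identity in `A` that defines it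
holds in `I ^ i` (`phi_zPoly`). As `φ` is surjective, `K[X] / 𝔞` maps onto the fiber cone, and it
remains to see that the fiber cone of an `𝔪`-primary ideal has dimension at least `dim A`
(`ringKrullDim_le_fiberCone`). This uses the extended Rees algebra `B = A[It, t⁻¹]`. A chain of
primes `p` of `A` of length `dim A` gives the chain of primes `p A[t, t⁻¹] ∩ B`, and on top of it
there is a maximal ideal that contains `t⁻¹`. So by Krull's principal ideal theorem
`dim B / (t⁻¹) ≥ dim A`. Every prime of `B` containing `t⁻¹` contains `I`, hence `𝔪`, so `B / (t⁻¹)`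
has the same dimension as `B / (t⁻¹, 𝔪)`, which is a quotient of the fiber cone.
-/

/-! ### Dimension of quotients of a polynomial ring -/

theorem ringKrullDim_le_of_isIntegral {R S : Type*} [CommRing R] [CommRing S] [Algebra R S]
    [Algebra.IsIntegral R S] : ringKrullDim S ≤ ringKrullDim R :=
  Order.krullDim_le_of_strictMono (PrimeSpectrum.comap (algebraMap R S)) fun p q hpq ↦
    Ideal.IsIntegral.comap_lt_comap (I := p.asIdeal) (J := q.asIdeal) hpq

/-- If all variables are nilpotent in a nonzero quotient of a polynomial ring over a field, then
every prime of the quotient pulls back to the ideal of the origin. -/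
theorem ringKrullDim_eq_zero_of_isNilpotent_X {K σ T : Type*} [Field K] [CommRing T] [Nontrivial T]
    (g : MvPolynomial σ K →+* T) (hg : Function.Surjective g) (h : ∀ k, IsNilpotent (g (X k))) :
    ringKrullDim T = 0 := by
  rw [← ringKrullDimZero_iff_ringKrullDim_eq_zero, Ring.krullDimLE_zero_iff]
  intro p hp
  have hmax : (RingHom.ker (constantCoeff : MvPolynomial σ K →+* K)).IsMaximal :=
    RingHom.ker_isMaximal_of_surjective _ fun c ↦ ⟨C c, constantCoeff_C _ c⟩
  have hle : RingHom.ker (constantCoeff : MvPolynomial σ K →+* K) ≤ p.comap g := by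
    have hX : idealOfVars σ K ≤ p.comap g := by
      rw [Ideal.span_le]
      rintro _ ⟨k, rfl⟩
      obtain ⟨m, hm⟩ := h k
      exact hp.mem_of_pow_mem m (hm ▸ p.zero_mem)
    refine fun f hf ↦ hX ?_
    rw [← pow_one (idealOfVars σ K), mem_pow_idealOfVars_iff']
    intro e he
    rw [(Finsupp.degree_eq_zero_iff e).1 (by omega)]
    exact hf
  have := hmax.eq_of_le (Ideal.IsPrime.ne_top inferInstance) hle
  rw [← Ideal.map_comap_of_surjective g hg p, ← this]
  refine (Ideal.map_eq_top_or_isMaximal_of_surjective g hg hmax).resolve_left fun h ↦ hp.ne_top ?_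
  rw [← Ideal.map_comap_of_surjective g hg p, ← this, h]

theorem ringKrullDim_quotient_quotient_eq_zero {K σ : Type*} [Field K]
    {𝔞 J : Ideal (MvPolynomial σ K)} (hne : 𝔞 ⊔ J ≠ ⊤) {N : ℕ}
    (h : idealOfVars σ K ^ N ≤ 𝔞 ⊔ J) :
    ringKrullDim ((MvPolynomial σ K ⧸ 𝔞) ⧸ J.map (Ideal.Quotient.mk 𝔞)) = 0 := by
  rw [ringKrullDim_eq_of_ringEquiv (DoubleQuot.quotQuotEquivQuotSup 𝔞 J)]
  have : Nontrivial (MvPolynomial σ K ⧸ 𝔞 ⊔ J) := Ideal.Quotient.nontrivial_iff.2 hne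
  refine ringKrullDim_eq_zero_of_isNilpotent_X (Ideal.Quotient.mk (𝔞 ⊔ J))
    Ideal.Quotient.mk_surjective fun k ↦ ⟨N, ?_⟩
  rw [← map_pow, Ideal.Quotient.eq_zero_iff_mem]
  exact h (Ideal.pow_mem_pow (Ideal.subset_span (Set.mem_range_self k)) N)

/-- Graded Nakayama: by induction on the degree, every monomial is, modulo the homogeneous kernel
of `g`, a combination of monomials of degree less than `N` with coefficients that are polynomials in
the variables from `s`. Hence `S` is a finite module over the polynomial ring in these
variables. -/
theorem ringKrullDim_le_of_pow_idealOfVars_le {K σ S : Type*} [Field K] [Finite σ] [CommRing S]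
    (g : MvPolynomial σ K →+* S) (hg : Function.Surjective g)
    (hker : (RingHom.ker g).IsHomogeneous (homogeneousSubmodule σ K))
    (s : Set σ) (N : ℕ) (h : idealOfVars σ K ^ N ≤ RingHom.ker g ⊔ Ideal.span (X '' s)) :
    ringKrullDim S ≤ Nat.card s := by
  classical
  let ι : MvPolynomial s K →+* S :=
    g.comp (rename ((↑) : s → σ)).toRingHom
  let _ := ι.toAlgebra
  let G : Set S :=
    (fun e ↦ g (monomial e 1)) '' {e | Finsupp.degree e < N}
  let M : Submodule (MvPolynomial s K) S := Submodule.span _ G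
  have hC : ∀ (c : K) (f : MvPolynomial σ K), g f ∈ M →
      g (C c * f) ∈ M := by
    intro c f hf
    have := M.smul_mem (C c) hf
    rwa [Algebra.smul_def, show algebraMap _ S (C c) =
      g (C c) by simp [RingHom.algebraMap_toAlgebra, ι], ← map_mul] at this
  have hX : ∀ i ∈ s, ∀ (f : MvPolynomial σ K), g f ∈ M →
      g (X i * f) ∈ M := by
    intro i hi f hf
    have := M.smul_mem (X ⟨i, hi⟩) hf
    rwa [Algebra.smul_def, show algebraMap _ S (X (⟨i, hi⟩ : s) : MvPolynomial s K) =
      g (X i) by simp [RingHom.algebraMap_toAlgebra, ι], ← map_mul] at this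
  have hmono : ∀ (m : ℕ) (e : σ →₀ ℕ), e.degree = m →
      g (monomial e 1) ∈ M := by
    intro m
    induction m using Nat.strong_induction_on with
    | _ m ih =>
      intro e he
      by_cases hm : m < N
      · exact Submodule.subset_span ⟨e, by simpa [he] using hm, rfl⟩
      have hmem : monomial e (1 : K) ∈ idealOfVars σ K ^ N :=
        (monomial_mem_pow_idealOfVars_iff N e one_ne_zero).2 (by omega)
      obtain ⟨a, ha, f, hf, hag⟩ := Submodule.mem_sup.1 (h hmem)
      have hcomp : monomial e (1 : K) = homogeneousComponent m a + homogeneousComponent m f := by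
        rw [← map_add, hag, homogeneousComponent_eq_self (isHomogeneous_monomial _ he)]
      have ha' : g (homogeneousComponent m a) = 0 :=
        homogeneousComponent_mem_of_mem hker ha m
      rw [hcomp, map_add, ha', zero_add, homogeneousComponent_apply, map_sum]
      refine Submodule.sum_mem _ fun u hu ↦ ?_
      obtain ⟨hu, hum⟩ := Finset.mem_filter.1 hu
      obtain ⟨i, hi, hui⟩ := mem_ideal_span_X_image.1 hf u hu
      obtain ⟨v, rfl⟩ : ∃ v, u = Finsupp.single i 1 + v :=
        le_iff_exists_add.1 (Finsupp.single_le_iff.2 (Nat.one_le_iff_ne_zero.2 hui))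
      rw [map_add, Finsupp.degree_single] at hum
      have hv := hX i hi _ (ih v.degree (by omega) v rfl)
      have := hC (coeff (Finsupp.single i 1 + v) f) _ hv
      rwa [X, monomial_mul, one_mul, C_mul_monomial, mul_one] at this
  have htop : M = ⊤ := by
    refine eq_top_iff.2 fun z _ ↦ ?_
    obtain ⟨f, rfl⟩ := hg z
    rw [f.as_sum, map_sum]
    refine Submodule.sum_mem _ fun e _ ↦ ?_
    have := hC (coeff e f) _ (hmono _ e rfl)
    rwa [C_mul_monomial, mul_one] at this
  have hfin : G.Finite :=
    (Finsupp.finite_of_degree_lt N).image _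
  have : Module.Finite (MvPolynomial s K) S :=
    ⟨htop ▸ Submodule.fg_span hfin⟩
  refine ringKrullDim_le_of_isIntegral.trans (?_ : ringKrullDim (MvPolynomial s K) ≤ _)
  rw [MvPolynomial.ringKrullDim_of_isNoetherianRing, ringKrullDim_eq_zero_of_field, zero_add]

noncomputable section

/-! ### The extended Rees algebra and the dimension of the fiber cone -/

open scoped LaurentPolynomial in
/-- The extended Rees algebra `A[It, t⁻¹]`, as a subalgebra of the Laurent polynomials over `A`. -/
def extendedRees {A : Type*} [CommRing A] (I : Ideal A) : Subalgebra A A[T;T⁻¹] :=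
  (reesAlgebra I).map Polynomial.toLaurentAlg ⊔ Algebra.adjoin A {LaurentPolynomial.T (-1)}

namespace extendedRees

variable {A : Type*} [CommRing A] (I : Ideal A)

instance [IsNoetherianRing A] : IsNoetherianRing (extendedRees I) :=
  isNoetherianRing_of_fg (((reesAlgebra.fg (IsNoetherian.noetherian I)).map _).sup
    ⟨{LaurentPolynomial.T (-1)}, by simp⟩)

/-- The element `t⁻¹` of the extended Rees algebra. -/
def tInv : extendedRees I :=
  ⟨LaurentPolynomial.T (-1),
    (le_sup_right : _ ≤ extendedRees I) (Algebra.subset_adjoin (Set.mem_singleton _))⟩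

/-- The inclusion of the Rees algebra into the extended Rees algebra. -/
def ofRees : reesAlgebra I →ₐ[A] extendedRees I :=
  (Polynomial.toLaurentAlg.comp (reesAlgebra I).val).codRestrict (extendedRees I) fun f ↦
    (le_sup_left : _ ≤ extendedRees I) ⟨f, f.2, rfl⟩

/-- The contraction to `A[It, t⁻¹]` of the extension of `p` to the Laurent polynomials; it is
prime when `p` is. -/
def extend (p : Ideal A) : Ideal (extendedRees I) :=
  RingHom.ker ((AddMonoidAlgebra.mapRingHom ℤ (Ideal.Quotient.mk p)).comp
    (extendedRees I).val.toRingHom)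

variable {I} in
theorem mem_extend {p : Ideal A} {f : extendedRees I} :
    f ∈ extend I p ↔ ∀ i, (f : LaurentPolynomial A).coeff i ∈ p := by
  simp [extend, RingHom.mem_ker, AddMonoidAlgebra.ext_iff, Finsupp.ext_iff,
    Ideal.Quotient.eq_zero_iff_mem]

instance (p : Ideal A) [p.IsPrime] : (extend I p).IsPrime := RingHom.ker_isPrime _

variable {I} in
theorem algebraMap_mem_extend {p : Ideal A} {a : A} :
    algebraMap A (extendedRees I) a ∈ extend I p ↔ a ∈ p := by
  rw [mem_extend, Subalgebra.coe_algebraMap, LaurentPolynomial.algebraMap_apply]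
  simp only [LaurentPolynomial.C_apply]
  refine ⟨fun h ↦ by simpa using h 0, fun h i ↦ ?_⟩
  split_ifs
  exacts [h, p.zero_mem]

theorem extend_strictMono : StrictMono (extend I) := by
  refine Monotone.strictMono_of_injective
    (fun p q hpq f hf ↦ mem_extend.2 fun i ↦ hpq (mem_extend.1 hf i)) fun p q h ↦ ?_
  ext a
  rw [← algebraMap_mem_extend (I := I), h, algebraMap_mem_extend]

variable {I} in
/-- Modulo a prime that contains `I`, the extended Rees algebra becomes `k[t⁻¹]`. -/
theorem exists_mapRingHom_eq {p : Ideal A} (hI : I ≤ p) (f : extendedRees I) :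
    ∃ q : Polynomial (A ⧸ p), AddMonoidAlgebra.mapRingHom ℤ (Ideal.Quotient.mk p) f.1 =
      LaurentPolynomial.invert (Polynomial.toLaurent q) := by
  let N : Subalgebra A (LaurentPolynomial A) :=
    { carrier := {f | ∃ q : Polynomial (A ⧸ p),
        AddMonoidAlgebra.mapRingHom ℤ (Ideal.Quotient.mk p) f =
          LaurentPolynomial.invert (Polynomial.toLaurent q)}
      mul_mem' := by
        rintro f g ⟨q, hq⟩ ⟨r, hr⟩
        exact ⟨q * r, by rw [map_mul, hq, hr, map_mul, map_mul]⟩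
      add_mem' := by
        rintro f g ⟨q, hq⟩ ⟨r, hr⟩
        exact ⟨q + r, by rw [map_add, hq, hr, map_add, map_add]⟩
      algebraMap_mem' := fun a ↦ ⟨Polynomial.C (Ideal.Quotient.mk p a), by
        rw [Polynomial.toLaurent_C, LaurentPolynomial.invert_C, LaurentPolynomial.algebraMap_apply,
          ← LaurentPolynomial.single_eq_C, ← LaurentPolynomial.single_eq_C,
          AddMonoidAlgebra.mapRingHom_single, Algebra.algebraMap_self_apply]⟩ }
  have hN : extendedRees I ≤ N := by
    rw [extendedRees, ← adjoin_monomial_eq_reesAlgebra, AlgHom.map_adjoin]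
    refine sup_le (Algebra.adjoin_le ?_) (Algebra.adjoin_le ?_)
    · rintro _ ⟨_, ⟨a, ha, rfl⟩, rfl⟩
      refine ⟨0, ?_⟩
      rw [Polynomial.toLaurentAlg_apply, ← Polynomial.C_mul_X_pow_eq_monomial,
        Polynomial.toLaurent_C_mul_X_pow, ← LaurentPolynomial.single_eq_C_mul_T,
        AddMonoidAlgebra.mapRingHom_single, Ideal.Quotient.eq_zero_iff_mem.2 (hI ha)]
      simp
    · rintro _ rfl
      refine ⟨Polynomial.X, ?_⟩
      rw [Polynomial.toLaurent_X, LaurentPolynomial.invert_T, LaurentPolynomial.T,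
        AddMonoidAlgebra.mapRingHom_single, map_one]
      rfl
  exact hN f.2

theorem extend_sup_tInv_ne_top {p : Ideal A} [p.IsPrime] (hI : I ≤ p) :
    extend I p ⊔ Ideal.span {tInv I} ≠ ⊤ := by
  intro h
  obtain ⟨f, hf, g, hg, hfg⟩ := Submodule.mem_sup.1 ((Ideal.eq_top_iff_one _).1 h)
  obtain ⟨b, rfl⟩ := Ideal.mem_span_singleton'.1 hg
  obtain ⟨q, hq⟩ := exists_mapRingHom_eq hI b
  have := congrArg (fun z : extendedRees I ↦
    AddMonoidAlgebra.mapRingHom ℤ (Ideal.Quotient.mk p) (z : LaurentPolynomial A)) hfg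
  have hf0 : AddMonoidAlgebra.mapRingHom ℤ (Ideal.Quotient.mk p) (f : LaurentPolynomial A) = 0 :=
    hf
  have ht : AddMonoidAlgebra.mapRingHom ℤ (Ideal.Quotient.mk p)
      (tInv I : LaurentPolynomial A) = LaurentPolynomial.invert
        (Polynomial.toLaurent (Polynomial.X : Polynomial (A ⧸ p))) := by
    rw [Polynomial.toLaurent_X, LaurentPolynomial.invert_T]
    refine (AddMonoidAlgebra.mapRingHom_single ..).trans ?_
    rw [map_one]
    rfl
  simp only [AddMemClass.coe_add, MulMemClass.coe_mul, OneMemClass.coe_one, map_add, map_mul,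
    map_one, hf0, zero_add, hq, ht] at this
  rw [← map_mul, ← map_mul, ← map_one LaurentPolynomial.invert,
    LaurentPolynomial.invert.injective.eq_iff, ← map_one Polynomial.toLaurent,
    Polynomial.toLaurent_injective.eq_iff] at this
  simpa using congrArg (Polynomial.eval 0) this

/-- A chain of primes of `A` extends to `A[It, t⁻¹]`, where one more prime, containing `t⁻¹`, fits
on top of it; Krull's principal ideal theorem then bounds the dimension modulo `t⁻¹` below. -/
theorem ringKrullDim_le_quotient_tInv [IsLocalRing A] [IsNoetherianRing A]
    (hI : I ≤ maximalIdeal A) :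
    ringKrullDim A ≤ ringKrullDim (extendedRees I ⧸ Ideal.span {tInv I}) := by
  obtain ⟨M, hM, hle⟩ := Ideal.exists_le_maximal _ (extend_sup_tInv_ne_top I hI)
  have htM : tInv I ∈ M := hle (Ideal.mem_sup_right (Ideal.mem_span_singleton_self _))
  have hlt : extend I (maximalIdeal A) < M := by
    refine lt_of_le_of_ne (le_sup_left.trans hle) fun h ↦ ?_
    rw [← h, mem_extend] at htM
    have := htM (-1)
    rw [tInv, LaurentPolynomial.T_apply, if_pos rfl] at this
    exact (maximalIdeal A).ne_top_iff_one.1 (Ideal.IsPrime.ne_top inferInstance) this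
  let F : PrimeSpectrum A → PrimeSpectrum (extendedRees I) := fun p ↦ ⟨extend I p.asIdeal,
    inferInstance⟩
  have h1 : (maximalIdeal A).height ≤ (extend I (maximalIdeal A)).height := by
    have := Order.height_le_height_apply_of_strictMono F
      (fun p q h ↦ extend_strictMono I h) (closedPoint A)
    rwa [← PrimeSpectrum.height_eq_orderHeight, ← PrimeSpectrum.height_eq_orderHeight] at this
  have h2 := Ideal.height_add_one_le_of_lt_of_isPrime hlt
  have h3 := Ideal.height_le_ringKrullDim_quotient_add_one htM
  rw [← IsLocalRing.maximalIdeal_height_eq_ringKrullDim]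
  have h4 : ((maximalIdeal A).height : WithBot ℕ∞) + 1 ≤ M.height := by
    exact_mod_cast (add_le_add_left h1 1).trans h2
  exact (ENat.WithBot.add_le_add_one_right_iff).1 (h4.trans h3)

variable {I} in
/-- `A[It, t⁻¹]` is generated by the Rees algebra and `t⁻¹`, so the Rees algebra maps onto every
quotient in which `t⁻¹` vanishes. -/
theorem mk_comp_ofRees_surjective {J : Ideal (extendedRees I)} (hJ : tInv I ∈ J) :
    Function.Surjective ((Ideal.Quotient.mkₐ A J).comp (ofRees I)) := by
  let N := (((Ideal.Quotient.mkₐ A J).comp (ofRees I)).range.comap (Ideal.Quotient.mkₐ A J)).map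
    (extendedRees I).val
  have hN : extendedRees I ≤ N := by
    refine sup_le ?_ (Algebra.adjoin_le ?_)
    · rintro _ ⟨f, hf, rfl⟩
      exact ⟨ofRees I ⟨f, hf⟩, ⟨⟨f, hf⟩, rfl⟩, rfl⟩
    · rintro _ rfl
      refine ⟨tInv I, ⟨0, ?_⟩, rfl⟩
      rw [map_zero]
      exact (Ideal.Quotient.eq_zero_iff_mem.2 hJ).symm
  intro z
  obtain ⟨f, rfl⟩ := Ideal.Quotient.mk_surjective z
  obtain ⟨g, hg, hgf⟩ := hN f.2
  obtain rfl : g = f := Subtype.ext hgf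
  exact hg

/-- For an `𝔪`-primary ideal `I`, a prime of `A[It, t⁻¹]` that contains `t⁻¹` contains
`I = (It) t⁻¹`, and therefore `𝔪`. -/
theorem map_maximalIdeal_le_of_tInv_mem [IsLocalRing A] (hI : I.radical = maximalIdeal A)
    {P : Ideal (extendedRees I)} [P.IsPrime] (hP : tInv I ∈ P) :
    (maximalIdeal A).map (algebraMap A (extendedRees I)) ≤ P := by
  rw [Ideal.map_le_iff_le_comap, ← hI, (Ideal.IsPrime.isRadical inferInstance).radical_le_iff]
  intro a ha
  have : algebraMap A (extendedRees I) a = ofRees I ⟨Polynomial.monomial 1 a,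
      reesAlgebra.monomial_mem.2 (by simpa using ha)⟩ * tInv I := by
    apply Subtype.ext
    change algebraMap A (LaurentPolynomial A) a =
      Polynomial.toLaurent (Polynomial.monomial 1 a) * LaurentPolynomial.T (-1)
    rw [← Polynomial.C_mul_X_pow_eq_monomial, Polynomial.toLaurent_C_mul_X_pow,
      LaurentPolynomial.mul_T_assoc, LaurentPolynomial.algebraMap_apply]
    simp
  rw [Ideal.mem_comap, this]
  exact P.mul_mem_left _ hP

end extendedRees

open extendedRees in
/-- The fiber cone of an `𝔪`-primary ideal has dimension at least `dim A`: it maps onto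
`A[It, t⁻¹] / (t⁻¹, 𝔪)`, which has the same spectrum as `A[It, t⁻¹] / (t⁻¹)`. -/
theorem ringKrullDim_le_fiberCone {A : Type*} [CommRing A] [IsLocalRing A] [IsNoetherianRing A]
    {I : Ideal A} (hI : I.radical = maximalIdeal A) :
    ringKrullDim A ≤ ringKrullDim (FiberCone I) := by
  refine (ringKrullDim_le_quotient_tInv I (hI ▸ Ideal.le_radical)).trans ?_
  let J : Ideal (extendedRees I) :=
    Ideal.span {tInv I} ⊔ (maximalIdeal A).map (algebraMap A (extendedRees I))
  have hloc : PrimeSpectrum.zeroLocus (Ideal.span {tInv I} : Set (extendedRees I)) =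
      PrimeSpectrum.zeroLocus (J : Set (extendedRees I)) := by
    ext P
    simp only [PrimeSpectrum.mem_zeroLocus, SetLike.coe_subset_coe, J, sup_le_iff]
    refine ⟨fun h ↦ ⟨h, map_maximalIdeal_le_of_tInv_mem I hI ?_⟩, And.left⟩
    exact h (Ideal.mem_span_singleton_self _)
  rw [ringKrullDim_quotient, hloc, ← ringKrullDim_quotient]
  have hJ : tInv I ∈ J := Ideal.mem_sup_left (Ideal.mem_span_singleton_self _)
  refine ringKrullDim_le_of_surjective
    (Ideal.Quotient.lift _ ((Ideal.Quotient.mkₐ A J).comp (ofRees I)).toRingHom ?_)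
    (Ideal.Quotient.lift_surjective_of_surjective _ _ (mk_comp_ofRees_surjective hJ))
  intro z hz
  rw [← RingHom.mem_ker]
  refine (Ideal.map_le_iff_le_comap.2 fun a ha ↦ ?_ : _ ≤ _) hz
  refine (RingHom.mem_ker ..).2 ?_
  refine (AlgHom.commutes ((Ideal.Quotient.mkₐ A J).comp (ofRees I)) a).trans ?_
  exact Ideal.Quotient.eq_zero_iff_mem.2 (Ideal.mem_sup_right (Ideal.mem_map_of_mem _ ha))
end

/-! ### The presentation of the fiber cone -/

section FiberCone

variable {A : Type*} [CommRing A] [IsLocalRing A]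

theorem fiberClass_add (I : Ideal A) (i : ℕ) (z w : ↥(I ^ i)) :
    fiberClass I i (z + w) = fiberClass I i z + fiberClass I i w := by
  rw [fiberClass, fiberClass, fiberClass, ← map_add]
  congr 1
  exact Subtype.ext (map_add (Polynomial.monomial i) (z : A) w)

theorem fiberClass_smul (I : Ideal A) (i : ℕ) (c : A) (z : ↥(I ^ i)) :
    fiberClass I i (c • z) = residueToFiberCone I (residue A c) * fiberClass I i z := by
  refine Eq.trans ?_ (map_mul (Ideal.Quotient.mk _) (algebraMap A (reesAlgebra I) c) _)
  refine congrArg (Ideal.Quotient.mk _) (Subtype.ext ?_)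
  refine ((Polynomial.monomial i).map_smul c (z : A)).trans ?_
  exact Algebra.smul_def c _

theorem fiberClass_mul (I : Ideal A) (i j : ℕ) (z : ↥(I ^ i)) (w : ↥(I ^ j)) :
    fiberClass I i z * fiberClass I j w =
      fiberClass I (i + j) ⟨z * w, pow_add I i j ▸ Ideal.mul_mem_mul z.2 w.2⟩ := by
  rw [fiberClass, fiberClass, fiberClass, ← map_mul]
  congr 1
  exact Subtype.ext (Polynomial.monomial_mul_monomial i j (z : A) w)

theorem fiberClass_sum (I : Ideal A) (i : ℕ) {κ : Type*} (s : Finset κ) (f : κ → ↥(I ^ i)) :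
    fiberClass I i (∑ k ∈ s, f k) = ∑ k ∈ s, fiberClass I i (f k) :=
  map_sum (AddMonoidHom.mk' (fiberClass I i) (fiberClass_add I i)) f s

variable {I : Ideal A} {n : ℕ} (x : Fin n → I)

theorem prod_mem_pow {R : Type*} [CommRing R] {J : Ideal R} {κ : Type*} (x : κ → J) {i : ℕ}
    (ℓ : Fin i → κ) : ∏ s, (x (ℓ s) : R) ∈ J ^ i := by
  simpa using Ideal.prod_mem_prod (s := Finset.univ) (I := fun _ : Fin i ↦ J)
    fun s _ ↦ (x (ℓ s)).2

theorem phi_C (c : ResidueField A) : phi x (C c) = residueToFiberCone I c :=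
  eval₂Hom_C ..

theorem phi_prod_X (i : ℕ) (ℓ : Fin i → Fin n) :
    phi x (∏ s, X (ℓ s)) = fiberClass I i ⟨∏ s, (x (ℓ s) : A), prod_mem_pow x ℓ⟩ := by
  induction i with
  | zero =>
    rw [Fin.prod_univ_zero, map_one]
    exact (map_one (Ideal.Quotient.mk _)).symm
  | succ i ih =>
    rw [Fin.prod_univ_castSucc, map_mul, ih fun s ↦ ℓ s.castSucc, phi, eval₂Hom_X', fiberClass_mul]
    congr 2
    exact (Fin.prod_univ_castSucc fun s ↦ (x (ℓ s) : A)).symm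

/-- The Rees algebra is generated over `A` by the `x k * t`, so `φ` is onto. -/
theorem phi_surjective (hx : I = Ideal.span (Set.range fun k ↦ (x k : A))) :
    Function.Surjective (phi x) := by
  let ψ : MvPolynomial (Fin n) A →ₐ[A] reesAlgebra I := aeval fun k ↦
    ⟨Polynomial.monomial 1 (x k : A), reesAlgebra.monomial_mem.2 ((pow_one I).symm ▸ (x k).2)⟩
  have hψ : reesAlgebra I ≤ ((reesAlgebra I).val.comp ψ).range := by
    refine (adjoin_monomial_eq_reesAlgebra I).ge.trans (Algebra.adjoin_le ?_)
    suffices h : Submodule.map (Polynomial.monomial 1) I ≤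
        Subalgebra.toSubmodule ((reesAlgebra I).val.comp ψ).range from h
    rw [Submodule.map_le_iff_le_comap]
    conv_lhs => rw [hx]
    refine Submodule.span_le.2 ?_
    rintro _ ⟨k, rfl⟩
    exact ⟨X k, congrArg Subtype.val (aeval_X _ k : ψ (X k) = _)⟩
  have hcomp : (phi x).comp (map (residue A)) = (Ideal.Quotient.mk _).comp ψ.toRingHom := by
    refine MvPolynomial.ringHom_ext (fun c ↦ ?_) fun k ↦ ?_
    · rw [RingHom.comp_apply, map_C, phi_C]
      exact congrArg (Ideal.Quotient.mk _) (ψ.commutes c).symm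
    · rw [RingHom.comp_apply, map_X, phi, eval₂Hom_X']
      exact congrArg (Ideal.Quotient.mk _) (aeval_X _ k : ψ (X k) = _).symm
  intro z
  obtain ⟨f, rfl⟩ := Ideal.Quotient.mk_surjective z
  obtain ⟨g, hg⟩ := hψ f.2
  obtain rfl : ψ g = f := Subtype.ext hg
  exact ⟨map (residue A) g, DFunLike.congr_fun hcomp g⟩

end FiberCone

/-! ### The ideal of relations -/

section Relations

variable {A : Type*} [CommRing A] [IsLocalRing A] {Q I : Ideal A} {d n : ℕ} {x : Fin n → I}
  {y : ∀ i : ℕ, Fin (numGen Q I i) → ↥(I ^ i)}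
  {Y : ∀ i : ℕ, Fin (numGen Q I i) → (Fin n →₀ ℕ)}
  {a : ∀ i : ℕ, (Fin i → Fin n) → Fin (numGen Q I i) → A}
  {b : ∀ i : ℕ, (Fin i → Fin n) → Fin n → (Fin (i - 1) → Fin n) → A}

theorem isHomogeneous_zPoly (hY : IsMonomialChoice x y Y) {i : ℕ} (hi : 2 ≤ i)
    (ℓ : Fin i → Fin n) : (zPoly d Y a b i ℓ).IsHomogeneous i := by
  have hprod : ∀ (j : ℕ) (q : Fin j → Fin n),
      (∏ s, X (q s) : MvPolynomial (Fin n) (ResidueField A)).IsHomogeneous j := by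
    intro j q
    simpa using IsHomogeneous.prod Finset.univ (fun s ↦ X (q s)) (fun _ ↦ 1)
      fun s _ ↦ isHomogeneous_X (ResidueField A) (q s)
  refine ((hprod i ℓ).sub (IsHomogeneous.sum _ _ _ fun j _ ↦ ?_)).sub
    (IsHomogeneous.sum _ _ _ fun p _ ↦ IsHomogeneous.sum _ _ _ fun q _ ↦ ?_)
  · simpa using (isHomogeneous_C (Fin n) (residue A (a i ℓ j))).mul
      (isHomogeneous_monomial (1 : ResidueField A) (hY i hi j).1)
  · have := (isHomogeneous_C (Fin n) (residue A (b i ℓ p q))).mul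
      ((isHomogeneous_X (ResidueField A) p).mul (hprod (i - 1) q))
    rwa [show 0 + (1 + (i - 1)) = i by omega] at this

/-- The relation that defines `Z` is an identity in `I ^ i`, so `Z` vanishes in the fiber cone. -/
theorem phi_zPoly (hY : IsMonomialChoice x y Y) (hab : IsCoeffChoice d x y a b) {i : ℕ}
    {ℓ : Fin i → Fin n} (h : IsRelIndex x y i ℓ) : phi x (zPoly d Y a b i ℓ) = 0 := by
  obtain ⟨j, rfl⟩ : ∃ j, i = j + 1 := ⟨i - 1, by have := h.1; omega⟩
  have hX : ∀ (p : Fin n) (q : Fin j → Fin n), phi x (X p * ∏ s, X (q s)) =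
      fiberClass I (j + 1) ⟨∏ s, (x ((Fin.cons p q : Fin (j + 1) → Fin n) s) : A),
        prod_mem_pow x _⟩ := by
    intro p q
    rw [← phi_prod_X, Fin.prod_univ_succ]
    simp
  have key : (⟨∏ s, (x (ℓ s) : A), prod_mem_pow x ℓ⟩ : ↥(I ^ (j + 1))) =
      ∑ k, a (j + 1) ℓ k • y (j + 1) k + ∑ p with p.val < d, ∑ q : Fin j → Fin n,
        b (j + 1) ℓ p q • ⟨∏ s, (x ((Fin.cons p q : Fin (j + 1) → Fin n) s) : A),
          prod_mem_pow x _⟩ := by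
    refine Subtype.ext ?_
    have := hab (j + 1) ℓ h
    rw [sub_eq_iff_eq_add'] at this
    simp only [Submodule.coe_add, Submodule.coe_sum, Submodule.coe_smul, smul_eq_mul,
      Fin.prod_univ_succ (n := j), Fin.cons_zero, Fin.cons_succ] at this ⊢
    exact this
  rw [zPoly, map_sub, map_sub, phi_prod_X, key, fiberClass_add, fiberClass_sum, fiberClass_sum]
  simp only [fiberClass_sum, fiberClass_smul, map_sum]
  rw [sub_sub, sub_eq_zero]
  congr 1
  · refine Finset.sum_congr rfl fun k _ ↦ ?_
    rw [map_mul, phi_C, (hY _ h.1 k).2]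
  · refine Finset.sum_congr rfl fun p _ ↦ Finset.sum_congr rfl fun q _ ↦ ?_
    rw [map_mul, phi_C]
    exact congrArg _ (hX p q).symm

omit [IsLocalRing A] in
/-- In degree `r + 1` there are no chosen generators, since `I ^ (r + 1) = Q I ^ r`. -/
theorem numGen_reductionNumber (hred : IsReduction Q I) :
    numGen Q I (reductionNumber Q I + 1) = 0 := by
  have h : I ^ (reductionNumber Q I + 1) = Q * I ^ reductionNumber Q I :=
    Nat.sInf_mem (s := {m | I ^ (m + 1) = Q * I ^ m}) (hred.2.imp fun _ h ↦ h.2)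
  rw [numGen, powQuot, Nat.add_sub_cancel, h, Submodule.mkQ_map_self, Submodule.spanFinrank_bot]

theorem card_setOf_val_lt_le (n d : ℕ) : Nat.card {k : Fin n | k.val < d} ≤ d := by
  simpa using Nat.card_le_card_of_injective
    (fun k : {k : Fin n | k.val < d} ↦ (⟨k.1.1, k.2⟩ : Fin d))
    fun k l h ↦ Subtype.ext (Fin.ext (by simpa using h))

/-- If the reduction number is zero, then `I = Q` and all of the `x k` are among the first `d`.
Otherwise every product of `r + 1` variables is the leading term of some `Z`, whose remaining terms
lie in `(X_1, …, X_d)` because there are no chosen generators in degree `r + 1`. -/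
theorem pow_idealOfVars_le_relIdeal_sup (hred : IsReduction Q I)
    (hn : n = Submodule.spanFinrank I)
    (hxQ : Q = Ideal.span ((fun k => (x k : A)) '' {k | k.val < d})) :
    idealOfVars (Fin n) (ResidueField A) ^ (reductionNumber Q I + 1) ≤
      relIdeal d x y Y a b ⊔ Ideal.span (X '' {k | k.val < d}) := by
  have hspan : ∀ k : Fin n, k.val < d → (X k : MvPolynomial (Fin n) (ResidueField A)) ∈
      Ideal.span (X '' {k | k.val < d}) := fun k hk ↦ Ideal.subset_span ⟨k, hk, rfl⟩
  rcases Nat.eq_zero_or_pos (reductionNumber Q I) with h0 | hpos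
  · have hIQ : I = Q := by
      have h : I ^ (reductionNumber Q I + 1) = Q * I ^ reductionNumber Q I :=
        Nat.sInf_mem (s := {m | I ^ (m + 1) = Q * I ^ m}) (hred.2.imp fun _ h ↦ h.2)
      simpa [h0] using h
    have hnd : n ≤ d := by
      calc n = Q.spanFinrank := hIQ ▸ hn
        _ ≤ ((fun k ↦ (x k : A)) '' {k | k.val < d}).ncard := by
          conv_lhs => rw [hxQ]
          exact Submodule.spanFinrank_span_le_ncard_of_finite (Set.toFinite _)
        _ ≤ {k : Fin n | k.val < d}.ncard := Set.ncard_image_le (Set.toFinite _)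
        _ ≤ d := card_setOf_val_lt_le n d
    rw [h0, zero_add, pow_one]
    refine le_sup_of_le_right (Ideal.span_le.2 ?_)
    rintro _ ⟨k, rfl⟩
    exact hspan k (k.2.trans_le hnd)
  · rw [idealOfVars, Ideal.span, Submodule.span_pow]
    refine Submodule.span_le.2 fun f hf ↦ ?_
    obtain ⟨v, rfl⟩ := Set.mem_pow.1 hf
    choose ℓ hℓ using fun s ↦ (v s).2
    have hempty : IsEmpty (Fin (numGen Q I (reductionNumber Q I + 1))) := by
      rw [numGen_reductionNumber hred]
      infer_instance
    have hrel : IsRelIndex x y (reductionNumber Q I + 1) ℓ :=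
      ⟨by omega, le_rfl, fun ⟨j, _⟩ ↦ hempty.elim j⟩
    have hZ : zPoly d Y a b _ ℓ ∈ relIdeal d x y Y a b := Ideal.subset_span ⟨_, ℓ, hrel, rfl⟩
    rw [List.prod_ofFn, ← Finset.prod_congr rfl fun s _ ↦ hℓ s]
    rw [zPoly, Finset.univ_eq_empty (α := Fin (numGen Q I (reductionNumber Q I + 1))),
      Finset.sum_empty, sub_zero] at hZ
    refine (Submodule.sub_mem_iff_left _ (Ideal.mem_sup_right ?_)).1 (Ideal.mem_sup_left hZ)
    refine sum_mem fun p hp ↦ sum_mem fun q _ ↦ ?_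
    exact Ideal.mul_mem_left _ _ (Ideal.mul_mem_right _ _ (hspan p (Finset.mem_filter.1 hp).2))

end Relations

theorem mainTheorem2
    {A : Type*} [CommRing A] [IsLocalRing A] [IsNoetherianRing A]
    (d : ℕ) (hd : ringKrullDim A = d)
    (I Q : Ideal A)
    (hI : I.radical = maximalIdeal A)
    (hQ : IsParameterIdeal Q) (hred : IsReduction Q I)
    (n : ℕ) (hn : n = Submodule.spanFinrank I)
    (x : Fin n → I)
    (hxI : I = Ideal.span (Set.range fun k => (x k : A)))
    (hxQ : Q = Ideal.span ((fun k => (x k : A)) '' {k | k.val < d}))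
    (y : ∀ i : ℕ, Fin (numGen Q I i) → ↥(I ^ i)) (hy : IsMinGenChoice Q x y)
    (Y : ∀ i : ℕ, Fin (numGen Q I i) → (Fin n →₀ ℕ)) (hY : IsMonomialChoice x y Y)
    (a : ∀ i : ℕ, (Fin i → Fin n) → Fin (numGen Q I i) → A)
    (b : ∀ i : ℕ, (Fin i → Fin n) → Fin n → (Fin (i - 1) → Fin n) → A)
    (hab : IsCoeffChoice d x y a b) :
    ((relIdeal d x y Y a b).IsHomogeneous (homogeneousSubmodule (Fin n) (ResidueField A)) ∧
      ∃ G : Set (MvPolynomial (Fin n) (ResidueField A)),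
        (∀ f ∈ G, ∃ i : ℕ, 2 ≤ i ∧ i ≤ reductionNumber Q I + 1 ∧ f.IsHomogeneous i) ∧
        relIdeal d x y Y a b = Ideal.span G) ∧
    (Ideal.span (Set.range X) ^ (reductionNumber Q I + 1) ≤
      relIdeal d x y Y a b ⊔ Ideal.span (X '' {k | k.val < d})) ∧
    (ringKrullDim (MvPolynomial (Fin n) (ResidueField A) ⧸ relIdeal d x y Y a b) = d ∧
      IsGradedParameterIdeal
        ((Ideal.span (X '' {k | k.val < d})).map
          (Ideal.Quotient.mk (relIdeal d x y Y a b)))) := by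
  set 𝔞 := relIdeal d x y Y a b
  set r := reductionNumber Q I
  have hgen : ∀ f ∈ {f | ∃ (i : ℕ) (ℓ : Fin i → Fin n),
      IsRelIndex x y i ℓ ∧ f = zPoly d Y a b i ℓ},
      ∃ i : ℕ, 2 ≤ i ∧ i ≤ r + 1 ∧ f.IsHomogeneous i := by
    rintro _ ⟨i, ℓ, h, rfl⟩
    exact ⟨i, h.1, h.2.1, isHomogeneous_zPoly hY h.1 ℓ⟩
  have hhom : 𝔞.IsHomogeneous (homogeneousSubmodule (Fin n) (ResidueField A)) :=
    Ideal.homogeneous_span _ _ fun f hf ↦ (hgen f hf).imp fun i h ↦ h.2.2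
  have hker : 𝔞 ≤ RingHom.ker (phi x) := by
    refine Ideal.span_le.2 ?_
    rintro _ ⟨i, ℓ, h, rfl⟩
    exact phi_zPoly hY hab h
  have hpow : idealOfVars (Fin n) (ResidueField A) ^ (r + 1) ≤
      𝔞 ⊔ Ideal.span (X '' {k | k.val < d}) :=
    pow_idealOfVars_le_relIdeal_sup hred hn hxQ
  have hdim : ringKrullDim (MvPolynomial (Fin n) (ResidueField A) ⧸ 𝔞) = d := by
    refine le_antisymm ?_ ?_
    · refine (ringKrullDim_le_of_pow_idealOfVars_le (Ideal.Quotient.mk 𝔞)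
        Ideal.Quotient.mk_surjective (by rwa [Ideal.mk_ker]) {k | k.val < d} (r + 1)
        (by rwa [Ideal.mk_ker])).trans ?_
      exact_mod_cast card_setOf_val_lt_le n d
    · rw [← hd]
      exact (ringKrullDim_le_fiberCone hI).trans (ringKrullDim_le_of_surjective
        (Ideal.Quotient.lift 𝔞 (phi x) fun f hf ↦ hker hf)
        (Ideal.Quotient.lift_surjective_of_surjective _ _ (phi_surjective x hxI)))
  refine ⟨⟨hhom, _, hgen, rfl⟩, hpow, hdim, d, hdim, ?_, ?_⟩
  · -- If `n < d`, the generators are padded with zeros.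
    refine ⟨fun k ↦ if h : k.val < n then X ⟨k, h⟩ else 0, fun k ↦ ⟨1, one_pos, ?_⟩, ?_⟩
    · dsimp only
      split_ifs
      exacts [isHomogeneous_X _ _, isHomogeneous_zero _ _ _]
    · rw [Ideal.map_span]
      refine le_antisymm (Ideal.span_mono ?_) (Ideal.span_le.2 ?_)
      · rintro _ ⟨_, ⟨k, hk, rfl⟩, rfl⟩
        exact ⟨⟨k, hk⟩, by simp⟩
      · rintro _ ⟨k, rfl⟩
        dsimp only
        split_ifs with h
        · exact Ideal.subset_span ⟨_, ⟨⟨k, h⟩, k.2, rfl⟩, rfl⟩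
        · rw [map_zero]
          exact zero_mem _
  · have hne : 𝔞 ⊔ Ideal.span (X '' {k | k.val < d}) ≠ ⊤ := by
      refine ne_top_of_le_ne_top (RingHom.ker_ne_top constantCoeff) (sup_le (fun f hf ↦ ?_) ?_)
      · refine Ideal.span_le.2 (fun g hg ↦ ?_) hf
        obtain ⟨i, hi, -, hgi⟩ := hgen g hg
        exact hgi.coeff_eq_zero (by simp; omega)
      · refine Ideal.span_le.2 ?_
        rintro _ ⟨k, -, rfl⟩
        exact constantCoeff_X _ k
    exact ringKrullDim_quotient_quotient_eq_zero hne hpow
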